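/- **Setting.** Let $(X,d)$ be a compact metric space with its Borel $\sigma$-algebra, $\mu$ a finite Borel measure on $X$, and $P$ a $\mu$-absolutely continuous probability measure on $X$. A $\mu$-density of $P$ is a measurable $h:X\to[0,\infty)$ with $dP=h\,d\mu$. *Level sets.* For $\rho\in\mathbb R$ let $M_\rho$ be the support of the measure $B\mapsto\mu(B\cap\{h\ge\rho\})$, where $h$ is a $\mu$-density of $P$ (the choice of $h$ does not matter). $P$ is *normal* if for every $\rho\in\mathbb R$ there are $\mu$-densities $h_1,h_2$ of $P$ with $\mu(M_\rho\setminus\{h_1\ge\rho\})=0$ and $\mu(\{h_2>\rho\}\setminus\mathring M_\rho)=0$. *Components.* For $A\subset X$ let $\mathcal C(A)$ be the set of topologically connected components of $A$. For $\tau>0$ let $\mathcal C_\tau(A)$ be the set of $\tau$-connected components of $A$, that is, of equivalence classes of the relation "there are $x=x_1,\dots,x_k=y$ in $A$ with $d(x_i,x_{i+1})<\tau$ for all $i<k$". A cell relating map (CRM) between partitions is a map $\zeta$ with $A'\subset\zeta(A')$ for all cells $A'$; it is unique if it exists. *Clusters.* $P$ *can be clustered between* $\rho^*\ge0$ and $\rho^{**}>\rho^*$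 if for all $\rho\in[0,\rho^{**}]$: $|\mathcal C(M_\rho)|\in\{1,2\}$; if $|\mathcal C(M_\rho)|=1$ then $\rho\le\rho^*$; if $|\mathcal C(M_\rho)|=2$ then $\rho\ge\rho^*$ and there is a bijective CRM $\mathcal C(M_{\rho^{**}})\to\mathcal C(M_\rho)$. Writing $A_1\ne A_2$ for the two components of $M_{\rho^{**}}$ and $\zeta_\rho:\mathcal C(M_{\rho^{**}})\to\mathcal C(M_\rho)$ for the CRM, the clusters are $A_i^*:=\bigcup_{\rho\in(\rho^*,\rho^{**}]}\zeta_\rho(A_i)$, $i=1,2$. *Thickness.* Let $A^{+\delta}:=\{x:d(x,A)\le\delta\}$ (with $d(x,\emptyset)=\infty$) and $A^{-\delta}:=X\setminus(X\setminus A)^{+\delta}$. $P$ has *thick levels* of order $\gamma\in(0,1]$ up to $\rho^{**}$ if there are $c_{\mathrm{thick}}\ge1$ and $\delta_{\mathrm{thick}}\in(0,1]$ with $\sup_{x\in M_\rho}d(x,M_\rho^{-\delta})\le c_{\mathrm{thick}}\delta^\gamma$ for all $\delta\in(0,\delta_{\mathrm{thick}}]$, $\rho\in(0,\rho^{**}]$.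 Put $\psi(\delta):=3c_{\mathrm{thick}}\delta^\gamma$. *Histograms.* For each $\delta\in(0,1]$ let $\mathcal A_\delta=(A_{\delta,1},\dots,A_{\delta,m_\delta})$ be a measurable partition of $X$, and suppose there are $d_{\mathrm{part}}>0$, $c_{\mathrm{part}}\ge1$ with $m_\delta\le c_{\mathrm{part}}\delta^{-d_{\mathrm{part}}}$, $\operatorname{diam}A_{\delta,j}\le\delta$ and $\mu(A_{\delta,j})\ge c_{\mathrm{part}}^{-1}\delta^{d_{\mathrm{part}}}$ for all $\delta\in(0,1]$ and all $j$. For $D=(x_1,\dots,x_n)\in X^n$ let $D(B):=\frac1n|\{i:x_i\in B\}|$, $h_{D,\delta}:=\sum_j\frac{D(A_{\delta,j})}{\mu(A_{\delta,j})}\mathbf 1_{A_{\delta,j}}$ and $L_{D,\rho}:=\{h_{D,\delta}\ge\rho\}$. *Algorithm with parameters $\tau,\varepsilon>0$ and $(L_{D,\rho})_{\rho\ge0}$.* Start with $\rho=0$. Repeat: identify the $B'\in\mathcal C_\tau(L_{D,\rho})$ with $B'\cap L_{D,\rho+2\varepsilon}\neq\emptyset$, then replace $\rho$ by $\rho+\varepsilon$;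 until the number of sets identified is different from $1$. Then replace $\rho$ by $\rho+2\varepsilon$, and return $\rho_D^*:=\rho$ and all $B'\in\mathcal C_\tau(L_{D,\rho})$ with $B'\cap L_{D,\rho+2\varepsilon}\ne\emptyset$. **Theorem.** Suppose that $P$ is normal, can be clustered between $\rho^*$ and $\rho^{**}$, and has thick levels of order $\gamma\in(0,1]$ up to $\rho^{**}$, and that $(\mathcal A_\delta)_{\delta\in(0,1]}$ is as above. Let $(\delta_n),(\varepsilon_n),(\tau_n)$ be strictly positive sequences converging to $0$ with $\psi(\delta_n)<\tau_n$ for all sufficiently large $n$ and $$\lim_{n\to\infty}\frac{\ln\delta_n^{-1}}{n\,\delta_n^{2d_{\mathrm{part}}}\,\varepsilon_n^2}=0 .$$ For $D\in X^n$ run the algorithm with parameters $\tau_n,\varepsilon_n$ and $L_{D,\rho}=\{h_{D,\delta_n}\ge\rho\}$. Then for all $\epsilon>0$ and $\varsigma\ge1$ there is an $n_0$ such that for all $n\ge n_0$, with $P^n$-probability at least $1-e^{-\varsigma}$, the algorithm stops and $$0<\rho_D^*-\rho^*\le\epsilon .$$ If, in addition, $\mu\bigl(\overline{A_1^*\cup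 A_2^*}\setminus(A_1^*\cup A_2^*)\bigr)=0$, then for all $\epsilon>0$ and $\varsigma\ge1$ there is an $n_0$ such that for all $n\ge n_0$, with $P^n$-probability at least $1-e^{-\varsigma}$, the algorithm stops, $0<\rho_D^*-\rho^*\le\epsilon$, and it returns exactly two sets, which can be numbered $B_1(D),B_2(D)$ such that $$\mu\bigl(B_1(D)\triangle A_1^*\bigr)+\mu\bigl(B_2(D)\triangle A_2^*\bigr)\le\epsilon .$$ -/

import Mathlib

open MeasureTheory Filter Topology
open scoped symmDiff ENNReal

namespace DensityClustering

/-! ### Density level sets -/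

section LevelSets

variable {X : Type*} [MetricSpace X] [MeasurableSpace X]

/-- `h` is a `μ`-density of `P`, that is `dP = h dμ` with `h : X → [0, ∞)` measurable. -/
structure IsDensity (μ P : Measure X) (h : X → ℝ) : Prop where
  measurable : Measurable h
  nonneg : ∀ x, 0 ≤ h x
  eq_withDensity : P = μ.withDensity (fun x => ENNReal.ofReal (h x))

/-- The support of the measure `μ_ρ(B) = μ(B ∩ {h ≥ ρ})`. -/
def levelSetOf (μ : Measure X) (h : X → ℝ) (ρ : ℝ) : Set X :=
  (μ.restrict {x | ρ ≤ h x}).support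

/-- The `ρ`-level set `M_ρ` of `P`: the support of `μ_ρ(B) = μ(B ∩ {h ≥ ρ})`, where `h` is a
`μ`-density of `P`. The Radon-Nikodym derivative is used as `h`; `levelSet_eq_levelSetOf` says that
every other `μ`-density of `P` gives the same set. -/
noncomputable def levelSet (μ P : Measure X) (ρ : ℝ) : Set X :=
  levelSetOf μ (fun x => (P.rnDeriv μ x).toReal) ρ

theorem levelSet_eq_levelSetOf {μ P : Measure X} [SigmaFinite μ] {h : X → ℝ}
    (hh : IsDensity μ P h) (ρ : ℝ) : levelSet μ P ρ = levelSetOf μ h ρ := by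
  have h1 : P.rnDeriv μ =ᵐ[μ] fun x => ENNReal.ofReal (h x) := by
    rw [hh.eq_withDensity]
    exact Measure.rnDeriv_withDensity μ hh.measurable.ennreal_ofReal
  have h2 : ({x | ρ ≤ (P.rnDeriv μ x).toReal} : Set X) =ᵐ[μ] {x | ρ ≤ h x} := by
    filter_upwards [h1] with x hx
    have hx' : (P.rnDeriv μ x).toReal = h x := by
      rw [hx, ENNReal.toReal_ofReal (hh.nonneg x)]
    apply propext
    change ρ ≤ (P.rnDeriv μ x).toReal ↔ ρ ≤ h x
    rw [hx']
  unfold levelSet levelSetOf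
  rw [Measure.restrict_congr_set h2]

/-- `P` is upper normal at level `ρ`. -/
def IsUpperNormalAt (μ P : Measure X) (ρ : ℝ) : Prop :=
  ∃ h : X → ℝ, IsDensity μ P h ∧ μ (levelSet μ P ρ \ {x | ρ ≤ h x}) = 0

/-- `P` is lower normal at level `ρ`. -/
def IsLowerNormalAt (μ P : Measure X) (ρ : ℝ) : Prop :=
  ∃ h : X → ℝ, IsDensity μ P h ∧ μ ({x | ρ < h x} \ interior (levelSet μ P ρ)) = 0

/-- `P` is normal: upper and lower normal at every level. -/
def IsNormal (μ P : Measure X) : Prop :=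
  ∀ ρ : ℝ, IsUpperNormalAt μ P ρ ∧ IsLowerNormalAt μ P ρ

end LevelSets

/-! ### Connected components, cell relating maps, tubes -/

section Components

variable {X : Type*}

/-- The partition `C(A)` of `A` into its topologically connected components. -/
def components [TopologicalSpace X] (A : Set X) : Set (Set X) :=
  connectedComponentIn A '' A

/-- `x` and `y` are `τ`-connected in `A`: there are `x = x₁, …, xₙ = y` in `A` with consecutive
distances `< τ`. -/
def TauConnectedIn [MetricSpace X] (τ : ℝ) (A : Set X) (x y : X) : Prop :=
  x ∈ A ∧ y ∈ A ∧ Relation.ReflTransGen (fun a b => a ∈ A ∧ b ∈ A ∧ dist a b < τ) x y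

/-- The partition `C_τ(A)` of `A` into its `τ`-connected components. -/
def tauComponents [MetricSpace X] (τ : ℝ) (A : Set X) : Set (Set X) :=
  (fun x => {y | TauConnectedIn τ A x y}) '' A

/-- The partition `𝒜` is persistent in the partition `ℬ`: there is a bijective cell relating map
`ζ : 𝒜 → ℬ`, that is a bijection with `A' ⊆ ζ A'` for all cells `A'` of `𝒜`. -/
def Persistent (𝒜 ℬ : Set (Set X)) : Prop :=
  ∃ ζ : Set X → Set X, Set.BijOn ζ 𝒜 ℬ ∧ ∀ A' ∈ 𝒜, A' ⊆ ζ A'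

/-- The value at `A'` of the cell relating map into the partition `ℬ`: the cell of `ℬ` that
contains the non-empty set `A'` (there is at most one; the value is `∅` if there is none). -/
def cellOver (ℬ : Set (Set X)) (A' : Set X) : Set X :=
  ⋃₀ {B | B ∈ ℬ ∧ A' ⊆ B}

/-- `A^{-δ} = X \ (X \ A)^{+δ}`, where `A^{+δ} = {x | d(x, A) ≤ δ}` (with `d(x, ∅) = ∞`) is
`Metric.cthickening δ A`. -/
def tubeMinus [MetricSpace X] (δ : ℝ) (A : Set X) : Set X :=
  (Metric.cthickening δ Aᶜ)ᶜ

end Components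

/-! ### Distributions that can be clustered -/

section Clustered

variable {X : Type*} [MetricSpace X] [MeasurableSpace X]

/-- `P` can be clustered between the levels `ρs` (`ρ*`) and `ρss` (`ρ**`). -/
structure CanBeClustered (μ P : Measure X) (ρs ρss : ℝ) : Prop where
  nonneg : 0 ≤ ρs
  lt : ρs < ρss
  one_or_two : ∀ ρ ∈ Set.Icc 0 ρss,
    (components (levelSet μ P ρ)).encard = 1 ∨ (components (levelSet μ P ρ)).encard = 2
  of_one : ∀ ρ ∈ Set.Icc 0 ρss, (components (levelSet μ P ρ)).encard = 1 → ρ ≤ ρs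
  of_two : ∀ ρ ∈ Set.Icc 0 ρss, (components (levelSet μ P ρ)).encard = 2 →
    ρs ≤ ρ ∧ Persistent (components (levelSet μ P ρss)) (components (levelSet μ P ρ))

/-- The cluster `A* = ⋃_{ρ ∈ (ρ*, ρ**]} ζ_ρ(C)` that belongs to the component `C` of `M_{ρ**}`,
where `ζ_ρ` is the cell relating map from the components of `M_{ρ**}` to those of `M_ρ`. -/
noncomputable def cluster (μ P : Measure X) (ρs ρss : ℝ) (C : Set X) : Set X :=
  ⋃ ρ ∈ Set.Ioc ρs ρss, cellOver (components (levelSet μ P ρ)) C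

/-- `P` has thick levels of order `γ` up to the level `ρss`, with constants `cThick`, `δThick`:
`sup_{x ∈ M_ρ} d(x, M_ρ^{-δ}) ≤ cThick * δ ^ γ` for all `δ ∈ (0, δThick]` and `ρ ∈ (0, ρss]`. -/
structure HasThickLevels (μ P : Measure X) (ρss γ cThick δThick : ℝ) : Prop where
  order_mem : γ ∈ Set.Ioc (0 : ℝ) 1
  one_le : 1 ≤ cThick
  width_mem : δThick ∈ Set.Ioc (0 : ℝ) 1
  thick : ∀ δ ∈ Set.Ioc 0 δThick, ∀ ρ ∈ Set.Ioc 0 ρss, ∀ x ∈ levelSet μ P ρ,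
    Metric.infEDist x (tubeMinus δ (levelSet μ P ρ)) ≤ ENNReal.ofReal (cThick * δ ^ γ)

/-- The thickness function `ψ`. -/
noncomputable def thicknessFun (γ cThick δ : ℝ) : ℝ := 3 * cThick * δ ^ γ

end Clustered

/-! ### Partitions, histograms and the clustering algorithm -/

section Algorithm

variable {X : Type*} [MetricSpace X] [MeasurableSpace X]

/-- For every `δ ∈ (0, 1]`, the sets `A δ 0, …, A δ (m δ - 1)` form a measurable partition of `X`
into at most `cPart * δ ^ (-dPart)` cells, each of diameter at most `δ` and of `μ`-measure at least
`cPart⁻¹ * δ ^ dPart`. Values of `m` and `A` at other `δ` are irrelevant. -/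
structure IsPartitionFamily (μ : Measure X) (m : ℝ → ℕ) (A : (δ : ℝ) → Fin (m δ) → Set X)
    (dPart cPart : ℝ) : Prop where
  dim_pos : 0 < dPart
  one_le : 1 ≤ cPart
  measurableSet : ∀ δ ∈ Set.Ioc (0 : ℝ) 1, ∀ j, MeasurableSet (A δ j)
  disjoint : ∀ δ ∈ Set.Ioc (0 : ℝ) 1, ∀ i j, i ≠ j → Disjoint (A δ i) (A δ j)
  cover : ∀ δ ∈ Set.Ioc (0 : ℝ) 1, ⋃ j, A δ j = Set.univ
  card_le : ∀ δ ∈ Set.Ioc (0 : ℝ) 1, (m δ : ℝ) ≤ cPart * δ ^ (-dPart)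
  diam_le : ∀ δ ∈ Set.Ioc (0 : ℝ) 1, ∀ j, ∀ x ∈ A δ j, ∀ y ∈ A δ j, dist x y ≤ δ
  le_measure : ∀ δ ∈ Set.Ioc (0 : ℝ) 1, ∀ j, cPart⁻¹ * δ ^ dPart ≤ μ.real (A δ j)

/-- The empirical measure `D(S)` of a set `S` for the data set `D = (x₁, …, xₙ)`. -/
noncomputable def empirical {n : ℕ} (D : Fin n → X) (S : Set X) : ℝ :=
  (∑ i, S.indicator (fun _ => (1 : ℝ)) (D i)) / n

/-- The histogram `h_{D,δ}(x) = ∑ j, D(A_j) / μ(A_j) * 1_{A_j}(x)` over the cells `A_j`. -/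
noncomputable def histogram (μ : Measure X) {m n : ℕ} (A : Fin m → Set X) (D : Fin n → X)
    (x : X) : ℝ :=
  ∑ j, (A j).indicator (fun _ => empirical D (A j) / μ.real (A j)) x

/-- The `τ`-connected components `B'` of `L_ρ` that satisfy `B' ∩ L_{ρ+2ε} ≠ ∅`. -/
def selected (τ ε : ℝ) (L : ℝ → Set X) (ρ : ℝ) : Set (Set X) :=
  {B | B ∈ tauComponents τ (L ρ) ∧ (B ∩ L (ρ + 2 * ε)).Nonempty}

/-- The clustering algorithm with parameters `τ`, `ε` and the family `L` of level set estimates: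
starting with `ρ = 0`, it identifies the selected components at the current level `ρ`, then sets
`ρ ← ρ + ε`, and repeats this until the number of components identified is different from `1`. It
then sets `ρ ← ρ + 2ε` and returns this level together with the selected components at it.
`Returns τ ε L ρD ℬ` says that it stops, returning the level `ρD` and the collection `ℬ` of sets;
`k * ε` is the level that is considered in the last run through the loop. -/
def Returns (τ ε : ℝ) (L : ℝ → Set X) (ρD : ℝ) (ℬ : Set (Set X)) : Prop :=
  ∃ k : ℕ, (∀ i < k, (selected τ ε L (i * ε)).encard = 1) ∧
    (selected τ ε L (k * ε)).encard ≠ 1 ∧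
    ρD = k * ε + ε + 2 * ε ∧ ℬ = selected τ ε L ρD

/-- The algorithm is run on the level sets `{h_{D,δ} ≥ ρ}`, `ρ ≥ 0`, of the histogram with cells
`A`, and it returns the level `ρD` and the collection `ℬ`. -/
def HistogramReturns (μ : Measure X) {m n : ℕ} (A : Fin m → Set X) (τ ε : ℝ) (D : Fin n → X)
    (ρD : ℝ) (ℬ : Set (Set X)) : Prop :=
  Returns τ ε (fun ρ => {x | ρ ≤ histogram μ A D x}) ρD ℬ

end Algorithm

end DensityClustering

/-! A deterministic and a probabilistic half meet in `IsEstimate`, that is, in the sandwich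
`M_{ρ+ε}^{-δ} ⊆ L_ρ ⊆ M_{ρ-ε}^{+δ}` together with thickness.

Probability: Hoeffding's inequality and a union bound over the cells put every relative frequency
within `ε` times the least cell measure of its probability. On this event the histogram differs from
`P(A_j)/μ(A_j)` by less than `ε`. A cell has diameter at most `δ`, so it lies in `M_{ρ+ε}` if it
meets the `δ`-interior, and it misses `M_{ρ-ε}` if it leaves the `δ`-tube; normality turns this into
the sandwich (`isEstimate_histogram`). The rate condition makes the failure probability small.

Determinism: a component of `M_{ρ+ε}` is connected by chains of arbitrarily small steps, and
thickness moves each link into `L_ρ` by less than `τ/3`, so its trace stays `τ`-connected.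
Conversely, at a fixed `r > ρ*` the two components are disjoint compact sets with a gap `Δ`, which
chains in `L_ρ` cannot cross once `τ` is small and `ρ ≥ r + ε`. Hence the scan cannot stop before
`ρ* - ε` and must stop by `r + 2ε` (`IsEstimate.returns`).

Clusters: each returned set contains the `δ`-interior of a component at a fixed level, and by
normality such interiors exhaust the cluster (`exists_measure_cluster_diff_le`). Both sets lie in
the `δ`-tube around the union of the clusters, whose excess measure vanishes by the boundary
assumption. -/

namespace DensityClustering

/-! ### Chains with small steps -/

section Chains

variable {X : Type*} [MetricSpace X] {τ τ' : ℝ} {A B : Set X} {x y z : X}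

theorem TauConnectedIn.refl (hx : x ∈ A) : TauConnectedIn τ A x x :=
  ⟨hx, hx, .refl⟩

theorem TauConnectedIn.symm (h : TauConnectedIn τ A x y) : TauConnectedIn τ A y x := by
  refine ⟨h.2.1, h.1, ?_⟩
  have hs : Std.Symm (fun a b : X => a ∈ A ∧ b ∈ A ∧ dist a b < τ) := ⟨fun a b hab =>
    ⟨hab.2.1, hab.1, by rw [dist_comm]; exact hab.2.2⟩⟩
  exact Relation.ReflTransGen.stdSymm.symm _ _ h.2.2

theorem TauConnectedIn.trans (h : TauConnectedIn τ A x y) (h' : TauConnectedIn τ A y z) :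
    TauConnectedIn τ A x z :=
  ⟨h.1, h'.2.1, h.2.2.trans h'.2.2⟩

theorem TauConnectedIn.of_dist_lt (hx : x ∈ A) (hy : y ∈ A) (h : dist x y < τ) :
    TauConnectedIn τ A x y :=
  ⟨hx, hy, .single ⟨hx, hy, h⟩⟩

theorem TauConnectedIn.mono (h : TauConnectedIn τ A x y) (hτ : τ ≤ τ') (hAB : A ⊆ B) :
    TauConnectedIn τ' B x y :=
  ⟨hAB h.1, hAB h.2.1, Relation.ReflTransGen.mono (fun _ _ hab =>
    ⟨hAB hab.1, hAB hab.2.1, hab.2.2.trans_le hτ⟩) _ _ h.2.2⟩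

theorem setOf_tauConnectedIn_eq_iff (hy : y ∈ A) :
    {w | TauConnectedIn τ A x w} = {w | TauConnectedIn τ A y w} ↔ TauConnectedIn τ A x y := by
  constructor
  · intro h
    have : y ∈ {w | TauConnectedIn τ A y w} := TauConnectedIn.refl hy
    rw [← h] at this
    exact this
  · intro h
    ext w
    exact ⟨fun hw => h.symm.trans hw, fun hw => h.trans hw⟩

/-- The relation is symmetric and transitive, and it holds locally because nearby points are one
step apart; preconnectedness makes it global. -/
theorem tauConnectedIn_of_isPreconnected (hA : IsPreconnected A) (hτ : 0 < τ) (hx : x ∈ A)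
    (hy : y ∈ A) : TauConnectedIn τ A x y := by
  refine hA.induction₂ (fun a b => TauConnectedIn τ A a b) ?_ ?_ ?_ hx hy
  · intro a ha
    filter_upwards [self_mem_nhdsWithin, mem_nhdsWithin_of_mem_nhds (Metric.ball_mem_nhds a hτ)]
      with b hb hb'
    exact .of_dist_lt ha hb (by rw [dist_comm]; exact hb')
  · intro a b c _ _ _ hab hbc
    exact hab.trans hbc
  · intro a b _ _ hab
    exact hab.symm

/-- A chain in `C` can be shadowed by a chain in `L` through nearby points. -/
theorem TauConnectedIn.shadow {C L : Set X} {s : ℝ} (hs : 3 * s ≤ τ) (h0 : 0 < s)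
    (hCL : ∀ c ∈ C, ∃ v ∈ L, dist c v < s) (h : TauConnectedIn s C x y) {z w : X} (hz : z ∈ L)
    (hxz : dist x z < s) (hw : w ∈ L) (hyw : dist y w < s) : TauConnectedIn τ L z w := by
  obtain ⟨-, -, h⟩ := h
  induction h generalizing w with
  | refl =>
    refine .of_dist_lt hz hw ?_
    have := dist_triangle_left z w x
    linarith
  | @tail b c _ hbc ih =>
    obtain ⟨v, hv, hbv⟩ := hCL b hbc.1
    refine (ih hv hbv).trans (.of_dist_lt hv hw ?_)
    -- Three legs, each shorter than `s`: this is where `3 * s ≤ τ` comes from.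
    have h1 := dist_triangle4 v b c w
    rw [dist_comm v b] at h1
    linarith [hbc.2.2]

/-- A chain with small steps that stays close to the union of two distant sets cannot pass from one
of them to the other. -/
theorem TauConnectedIn.near_of_separated {C₁ C₂ L : Set X} {s Δ : ℝ} (hΔ : τ + 2 * s ≤ Δ)
    (hsep : ∀ a ∈ C₁, ∀ b ∈ C₂, Δ ≤ dist a b) (hL : ∀ v ∈ L, ∃ c ∈ C₁ ∪ C₂, dist v c < s)
    (h : TauConnectedIn τ L x y) (hx : ∃ c ∈ C₁, dist x c < s) : ∃ c ∈ C₁, dist y c < s := by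
  obtain ⟨-, -, h⟩ := h
  induction h with
  | refl => exact hx
  | @tail b c _ hbc ih =>
    obtain ⟨p, hp, hbp⟩ := ih
    obtain ⟨q, hq | hq, hcq⟩ := hL c hbc.2.1
    · exact ⟨q, hq, hcq⟩
    · exfalso
      have h1 := hsep p hp q hq
      have h2 := dist_triangle4 p b c q
      rw [dist_comm p b] at h2
      linarith [hbc.2.2]

end Chains

/-! ### The algorithm on an estimate of two branches -/

section Deterministic

variable {X : Type*} [MetricSpace X]

theorem tubeMinus_mono {δ : ℝ} {A B : Set X} (h : A ⊆ B) : tubeMinus δ A ⊆ tubeMinus δ B :=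
  Set.compl_subset_compl.2 (Metric.cthickening_subset_of_subset δ (Set.compl_subset_compl.2 h))

theorem tubeMinus_anti {δ δ' : ℝ} (h : δ ≤ δ') (A : Set X) : tubeMinus δ' A ⊆ tubeMinus δ A :=
  Set.compl_subset_compl.2 (Metric.cthickening_mono h _)

theorem isOpen_tubeMinus (δ : ℝ) (A : Set X) : IsOpen (tubeMinus δ A) :=
  Metric.isClosed_cthickening.isOpen_compl

/-- A decreasing family of closed sets, each of which consists, up to the level `ρss`, of the two
components that contain `a₁` and `a₂`, where these differ above `ρs` and agree below `ρs`. -/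
structure TwoBranches (M : ℝ → Set X) (ρs ρss : ℝ) (a₁ a₂ : X) : Prop where
  nonneg : 0 ≤ ρs
  lt : ρs < ρss
  anti : Antitone M
  closed : ∀ r, IsClosed (M r)
  mem₁ : a₁ ∈ M ρss
  mem₂ : a₂ ∈ M ρss
  eq_union : ∀ r ∈ Set.Icc 0 ρss,
    M r = connectedComponentIn (M r) a₁ ∪ connectedComponentIn (M r) a₂
  disjoint : ∀ r ∈ Set.Ioc ρs ρss,
    Disjoint (connectedComponentIn (M r) a₁) (connectedComponentIn (M r) a₂)
  le_of_ne : ∀ r ∈ Set.Icc 0 ρss,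
    connectedComponentIn (M r) a₁ ≠ connectedComponentIn (M r) a₂ → ρs ≤ r

/-- The sets `L ρ` estimate the level sets `M ρ` with vertical uncertainty `ε` and horizontal
uncertainty `δ`, where `δ < s` and every point of `M r` is `s`-close to the `δ`-interior. -/
structure IsEstimate (M L : ℝ → Set X) (ρss δ ε s : ℝ) : Prop where
  pos : 0 < ε
  lt : δ < s
  nonneg : 0 ≤ δ
  anti : Antitone L
  inner : ∀ ρ, tubeMinus δ (M (ρ + ε)) ⊆ L ρ
  outer : ∀ ρ, L ρ ⊆ Metric.cthickening δ (M (ρ - ε))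
  thick : ∀ r ∈ Set.Ioc 0 ρss, ∀ x ∈ M r, ∃ z ∈ tubeMinus δ (M r), dist x z < s

namespace IsEstimate

variable {M L : ℝ → Set X} {ρs ρss δ ε s τ : ℝ} {a₁ a₂ z₁ z₂ : X}

theorem exists_near (hE : IsEstimate M L ρss δ ε s) {ρ : ℝ} {x : X} (hx : x ∈ L ρ) :
    ∃ y ∈ M (ρ - ε), dist x y < s := by
  have h := Metric.cthickening_subset_thickening' (hE.nonneg.trans_lt hE.lt) hE.lt _ (hE.outer ρ hx)
  exact Metric.mem_thickening_iff.1 h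

theorem subset_of_le (hE : IsEstimate M L ρss δ ε s) (hM : Antitone M) {ρ r : ℝ}
    (hr : ρ + ε ≤ r) : tubeMinus δ (M r) ⊆ L ρ :=
  (tubeMinus_mono (hM hr)).trans (hE.inner ρ)

/-- Thickness replaces each link of an `s`-chain in the component by a point of the `δ`-interior of
`M (ρ + ε)`, which lies in `L ρ`. The shift by `ε` also makes the level positive, as thickness
requires. -/
theorem connected_of_mem (hE : IsEstimate M L ρss δ ε s) (hs : 3 * s ≤ τ)
    {ρ : ℝ} (hρ : 0 ≤ ρ) (hρ' : ρ + ε ≤ ρss) {x y z w a : X}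
    (hx : x ∈ connectedComponentIn (M (ρ + ε)) a) (hy : y ∈ connectedComponentIn (M (ρ + ε)) a)
    (hz : z ∈ L ρ) (hxz : dist x z < s) (hw : w ∈ L ρ) (hyw : dist y w < s) :
    TauConnectedIn τ (L ρ) z w := by
  have h0 : 0 < s := hE.nonneg.trans_lt hE.lt
  refine TauConnectedIn.shadow hs h0 ?_
    (tauConnectedIn_of_isPreconnected isPreconnected_connectedComponentIn h0 hx hy) hz hxz hw hyw
  intro c hc
  obtain ⟨v, hv, hcv⟩ := hE.thick (ρ + ε) ⟨by linarith [hE.pos], hρ'⟩ c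
    (connectedComponentIn_subset _ _ hc)
  exact ⟨v, hE.inner ρ hv, hcv⟩

/-- The test against `L (ρ + 2 * ε)` removes spurious components: a point that passes it is close to
`M (ρ + ε)`, exactly the level at which `connected_of_mem` ties it to `z₁` or `z₂`. The two sets on
the right may coincide. -/
theorem selected_eq (hE : IsEstimate M L ρss δ ε s) (hM : TwoBranches M ρs ρss a₁ a₂)
    (hs : 3 * s ≤ τ) (hz₁ : z₁ ∈ tubeMinus δ (M ρss)) (hz₂ : z₂ ∈ tubeMinus δ (M ρss))
    (h₁ : dist a₁ z₁ < s) (h₂ : dist a₂ z₂ < s) {ρ : ℝ} (hρ : 0 ≤ ρ) (hρ' : ρ + 3 * ε ≤ ρss) :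
    selected τ ε L ρ =
      {{y | TauConnectedIn τ (L ρ) z₁ y}, {y | TauConnectedIn τ (L ρ) z₂ y}} := by
  have hε := hE.pos
  have hsub : tubeMinus δ (M ρss) ⊆ L (ρ + 2 * ε) := hE.subset_of_le hM.anti (by linarith)
  have hsub' : L (ρ + 2 * ε) ⊆ L ρ := hE.anti (by linarith)
  apply Set.Subset.antisymm
  · rintro B ⟨⟨x, hx, rfl⟩, w, hw, hwL⟩
    obtain ⟨y, hy, hwy⟩ := hE.exists_near hwL
    rw [show ρ + 2 * ε - ε = ρ + ε by ring] at hy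
    rw [dist_comm] at hwy
    have hxw : TauConnectedIn τ (L ρ) x w := hw
    rw [hM.eq_union (ρ + ε) ⟨by linarith, by linarith⟩] at hy
    have key : ∀ a z, a ∈ M ρss → z ∈ tubeMinus δ (M ρss) → dist a z < s →
        y ∈ connectedComponentIn (M (ρ + ε)) a →
        {v | TauConnectedIn τ (L ρ) x v} = {v | TauConnectedIn τ (L ρ) z v} := by
      intro a z ha hz haz hya
      rw [setOf_tauConnectedIn_eq_iff (hsub' (hsub hz))]
      refine hxw.trans (hE.connected_of_mem hs hρ (by linarith) hya
        (mem_connectedComponentIn (hM.anti (by linarith) ha)) (hsub' hwL) hwy (hsub' (hsub hz)) haz)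
    rcases hy with hy | hy
    · exact Or.inl (key a₁ z₁ hM.mem₁ hz₁ h₁ hy)
    · exact Or.inr (key a₂ z₂ hM.mem₂ hz₂ h₂ hy)
  · have key : ∀ z ∈ tubeMinus δ (M ρss), {y | TauConnectedIn τ (L ρ) z y} ∈ selected τ ε L ρ :=
      fun z hz => ⟨⟨z, hsub' (hsub hz), rfl⟩, z, TauConnectedIn.refl (hsub' (hsub hz)), hsub hz⟩
    rintro B (rfl | rfl)
    · exact key z₁ hz₁
    · exact key z₂ hz₂

/-- The algorithm stops at a level slightly above `ρs`, and it returns the two `τ`-components of its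
level set estimate that belong to the two branches. -/
theorem returns (hE : IsEstimate M L ρss δ ε s) (hM : TwoBranches M ρs ρss a₁ a₂)
    (hs : 3 * s ≤ τ) (hz₁ : z₁ ∈ tubeMinus δ (M ρss)) (hz₂ : z₂ ∈ tubeMinus δ (M ρss))
    (h₁ : dist a₁ z₁ < s) (h₂ : dist a₂ z₂ < s) {r Δ : ℝ} (hr : ρs < r) (hr' : r + 8 * ε ≤ ρss)
    (hsep : ∀ a ∈ connectedComponentIn (M r) a₁, ∀ b ∈ connectedComponentIn (M r) a₂,
      Δ ≤ dist a b) (hΔ : τ + 2 * s ≤ Δ) :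
    ∃ ρD, ρs + 2 * ε ≤ ρD ∧ ρD ≤ r + 5 * ε ∧
      ¬ TauConnectedIn τ (L ρD) z₁ z₂ ∧
      Returns τ ε L ρD
        {{y | TauConnectedIn τ (L ρD) z₁ y}, {y | TauConnectedIn τ (L ρD) z₂ y}} := by
  have hε := hE.pos
  have h0 : 0 < s := hE.nonneg.trans_lt hE.lt
  have hrs := hM.nonneg
  have hmem : ∀ ρ, ρ + ε ≤ ρss → ∀ z ∈ tubeMinus δ (M ρss), z ∈ L ρ := fun ρ hρ z hz =>
    hE.subset_of_le hM.anti hρ hz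
  have hsel : ∀ ρ, 0 ≤ ρ → ρ + 3 * ε ≤ ρss →
      ((selected τ ε L ρ).encard = 1 ↔ TauConnectedIn τ (L ρ) z₁ z₂) := by
    intro ρ hρ hρ'
    rw [hE.selected_eq hM hs hz₁ hz₂ h₁ h₂ hρ hρ', ← setOf_tauConnectedIn_eq_iff
      (hmem ρ (by linarith) z₂ hz₂)]
    constructor
    · intro h
      by_contra hne
      rw [Set.encard_pair hne] at h
      norm_num at h
    · intro h
      rw [h, Set.pair_eq_singleton, Set.encard_singleton]
  -- From `r + ε` on, `L ρ` stays `s`-close to `M r`, whose branches are `Δ` apart.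
  have hseparated : ∀ ρ, r + ε ≤ ρ → ¬ TauConnectedIn τ (L ρ) z₁ z₂ := by
    intro ρ hρ h
    have hmem₁ : a₁ ∈ connectedComponentIn (M r) a₁ :=
      mem_connectedComponentIn (hM.anti (by linarith) hM.mem₁)
    have hmem₂ : a₂ ∈ connectedComponentIn (M r) a₂ :=
      mem_connectedComponentIn (hM.anti (by linarith) hM.mem₂)
    obtain ⟨c, hc, hzc⟩ := h.near_of_separated hΔ hsep (fun v hv => by
      obtain ⟨y, hy, hvy⟩ := hE.exists_near hv
      refine ⟨y, ?_, hvy⟩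
      rw [← hM.eq_union r ⟨by linarith, by linarith⟩]
      exact hM.anti (by linarith) hy) ⟨a₁, hmem₁, by rwa [dist_comm]⟩
    have h3 := hsep c hc a₂ hmem₂
    have h4 := dist_triangle_left c a₂ z₂
    rw [dist_comm z₂ a₂] at h4
    have h5 : 0 ≤ τ := by linarith
    linarith
  -- The scan stops no later than this grid level. The final shift adds `3 * ε`, and `selected_eq`
  -- needs another `3 * ε` below `ρss`; hence the room `8 * ε`.
  obtain ⟨k, hk₁, hk₂⟩ : ∃ k : ℕ, r + ε ≤ k * ε ∧ k * ε ≤ r + 2 * ε := by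
    refine ⟨⌈(r + ε) / ε⌉₊, ?_, ?_⟩
    · rw [← div_le_iff₀ hε]; exact Nat.le_ceil _
    · have := (Nat.ceil_lt_add_one (show 0 ≤ (r + ε) / ε by
        apply div_nonneg <;> linarith)).le
      calc (⌈(r + ε) / ε⌉₊ : ℝ) * ε ≤ ((r + ε) / ε + 1) * ε := by gcongr
        _ = r + 2 * ε := by field_simp; ring
  have hex : ∃ k : ℕ, (selected τ ε L (k * ε)).encard ≠ 1 := by
    refine ⟨k, fun h => hseparated _ hk₁ ((hsel _ (by positivity) (by linarith)).1 h)⟩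
  classical
  obtain ⟨j, hj₁, hj₂⟩ : ∃ j : ℕ, (selected τ ε L (j * ε)).encard ≠ 1 ∧
      ∀ i < j, (selected τ ε L (i * ε)).encard = 1 :=
    ⟨Nat.find hex, Nat.find_spec hex, fun i hi => not_not.1 (Nat.find_min hex hi)⟩
  have hjk : j ≤ k := by
    by_contra! h
    exact hseparated _ hk₁ ((hsel _ (by positivity) (by linarith)).1 (hj₂ k h))
  have hjk' : (j : ℝ) * ε ≤ k * ε := by gcongr
  have hj0 : 0 ≤ (j : ℝ) * ε := by positivity
  have hjn : ¬ TauConnectedIn τ (L (j * ε)) z₁ z₂ := fun h =>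
    hj₁ ((hsel _ hj0 (by linarith)).2 h)
  -- If the branches still agreed at `j * ε + ε`, their common component would connect `z₁` and `z₂`
  -- in `L (j * ε)`.
  have hge : ρs ≤ j * ε + ε := by
    refine hM.le_of_ne _ ⟨by linarith, by linarith⟩ fun heq => hjn ?_
    have hm₁ := mem_connectedComponentIn
      (hM.anti (show j * ε + ε ≤ ρss by linarith) hM.mem₁)
    have hm₂ := mem_connectedComponentIn
      (hM.anti (show j * ε + ε ≤ ρss by linarith) hM.mem₂)
    rw [← heq] at hm₂
    exact hE.connected_of_mem hs hj0 (by linarith) hm₁ hm₂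
      (hmem _ (by linarith) _ hz₁) h₁ (hmem _ (by linarith) _ hz₂) h₂
  refine ⟨j * ε + ε + 2 * ε, by linarith, by linarith, fun h => hjn ?_, j, hj₂, hj₁, rfl, ?_⟩
  · exact h.mono le_rfl (hE.anti (by linarith))
  · exact (hE.selected_eq hM hs hz₁ hz₂ h₁ h₂ (by linarith) (by linarith)).symm

/-- A point of the `δ`-interior already belongs to `L ρ`, so it serves as its own shadow in
`connected_of_mem`. -/
theorem inter_tubeMinus_subset (hE : IsEstimate M L ρss δ ε s) (hM : Antitone M)
    (hs : 3 * s ≤ τ) (hz₁ : z₁ ∈ tubeMinus δ (M ρss)) (ha : a₁ ∈ M ρss)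
    (h₁ : dist a₁ z₁ < s) {ρ r : ℝ} (hρ : 0 ≤ ρ) (hr : ρ + ε ≤ r) (hr' : r ≤ ρss) :
    connectedComponentIn (M r) a₁ ∩ tubeMinus δ (M r) ⊆ {y | TauConnectedIn τ (L ρ) z₁ y} := by
  rintro x ⟨hx, hx'⟩
  refine hE.connected_of_mem hs hρ (hr.trans hr') (mem_connectedComponentIn (hM (hr.trans hr') ha))
    (connectedComponentIn_mono _ (hM hr) hx)
    (hE.subset_of_le hM (hr.trans hr') hz₁) h₁ (hE.subset_of_le hM hr hx') ?_
  rw [dist_self]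
  exact hE.nonneg.trans_lt hE.lt

end IsEstimate

end Deterministic

/-! ### Uniform concentration of the cell frequencies -/

section Concentration

open ProbabilityTheory

variable {X : Type*} [MeasurableSpace X]

theorem measurable_empirical {n : ℕ} {S : Set X} (hS : MeasurableSet S) :
    Measurable fun D : Fin n → X => empirical D S := by
  unfold empirical
  exact (Finset.measurable_sum _ fun i _ =>
    (measurable_const.indicator hS).comp (measurable_pi_apply i)).div_const _

/-- Hoeffding's inequality for the relative frequency of a set. -/
theorem measureReal_empirical_sub_ge_le (P : Measure X) [IsProbabilityMeasure P] {n : ℕ}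
    (hn : 0 < n) {S : Set X} (hS : MeasurableSet S) {t : ℝ} (ht : 0 ≤ t) :
    (Measure.pi fun _ : Fin n => P).real {D | t ≤ |empirical D S - P.real S|} ≤
      2 * Real.exp (-2 * n * t ^ 2) := by
  have hn' : (0 : ℝ) < n := by exact_mod_cast hn
  set Y : X → ℝ := fun x => S.indicator (fun _ => (1 : ℝ)) x - P.real S with hY
  have hm : Measurable (S.indicator fun _ => (1 : ℝ)) := measurable_const.indicator hS
  have hYm : Measurable Y := hm.sub_const _
  have hint : ∫ x, S.indicator (fun _ => (1 : ℝ)) x ∂P = P.real S := by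
    rw [integral_indicator_const _ hS, smul_eq_mul, mul_one]
  have hsub : HasSubgaussianMGF Y ((‖(1 : ℝ) - 0‖₊ / 2) ^ 2) P := by
    have := hasSubgaussianMGF_of_mem_Icc (μ := P) (X := S.indicator fun _ => (1 : ℝ)) (a := 0)
      (b := 1) hm.aemeasurable (Eventually.of_forall fun x => by
        by_cases hx : x ∈ S <;> simp [hx])
    rwa [hint] at this
  have hsub' : ∀ i : Fin n, HasSubgaussianMGF (fun D : Fin n → X => Y (D i))
      ((‖(1 : ℝ) - 0‖₊ / 2) ^ 2) (Measure.pi fun _ : Fin n => P) := by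
    intro i
    have := (measurePreserving_eval (fun _ : Fin n => P) i).map_eq
    exact HasSubgaussianMGF.of_map (μ := Measure.pi fun _ : Fin n => P) (Y := Function.eval i)
      (measurable_pi_apply i).aemeasurable (by rwa [this])
  have hind : iIndepFun (fun (i : Fin n) (D : Fin n → X) => Y (D i))
      (Measure.pi fun _ : Fin n => P) :=
    iIndepFun_pi (X := fun _ : Fin n => Y) fun _ => hYm.aemeasurable
  have hind' : iIndepFun (fun (i : Fin n) (D : Fin n → X) => -Y (D i))
      (Measure.pi fun _ : Fin n => P) :=
    iIndepFun_pi (X := fun _ : Fin n => -Y) fun _ => hYm.neg.aemeasurable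
  -- Each centred indicator has variance proxy `1/4`, so the exponent is `(n t)² / (2 · n/4) = 2 n
  -- t²`.
  have hc : -(n * t) ^ 2 / (2 * ∑ _i : Fin n, (((‖(1 : ℝ) - 0‖₊ / 2) ^ 2 : NNReal) : ℝ)) =
      -2 * n * t ^ 2 := by
    simp
    field_simp
  have hsum : ∀ D : Fin n → X, ∑ i, Y (D i) = n * (empirical D S - P.real S) := by
    intro D
    rw [hY, Finset.sum_sub_distrib, empirical]
    simp
    field_simp
  have hup := HasSubgaussianMGF.measure_sum_ge_le_of_iIndepFun hind (s := Finset.univ)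
    (fun i _ => hsub' i) (ε := n * t) (by positivity)
  have hlo := HasSubgaussianMGF.measure_sum_ge_le_of_iIndepFun hind' (s := Finset.univ)
    (fun i _ => (hsub' i).neg) (ε := n * t) (by positivity)
  push_cast at hc hup hlo
  rw [hc] at hup hlo
  have hset : {D : Fin n → X | t ≤ |empirical D S - P.real S|} ⊆
      {D | n * t ≤ ∑ i, Y (D i)} ∪ {D | n * t ≤ ∑ i, -Y (D i)} := by
    intro D hD
    simp only [Set.mem_ofPred_eq, Set.mem_union, Finset.sum_neg_distrib, hsum, le_abs] at hD ⊢
    rcases hD with hD | hD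
    · left; gcongr
    · right; rw [← mul_neg]; gcongr
  calc _ ≤ (Measure.pi fun _ : Fin n => P).real
        ({D | n * t ≤ ∑ i, Y (D i)} ∪ {D | n * t ≤ ∑ i, -Y (D i)}) := measureReal_mono hset
    _ ≤ _ := measureReal_union_le _ _
    _ ≤ _ := by linarith

theorem ofReal_le_measure_forall_empirical_sub_lt (P : Measure X) [IsProbabilityMeasure P] {n : ℕ}
    (hn : 0 < n) {m : ℕ} {A : Fin m → Set X} (hA : ∀ j, MeasurableSet (A j)) {t : ℝ}
    (ht : 0 ≤ t) :
    ENNReal.ofReal (1 - m * (2 * Real.exp (-2 * n * t ^ 2))) ≤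
      (Measure.pi fun _ : Fin n => P) {D | ∀ j, |empirical D (A j) - P.real (A j)| < t} := by
  rw [ENNReal.ofReal_le_iff_le_toReal (measure_ne_top _ _)]
  set G := {D : Fin n → X | ∀ j, |empirical D (A j) - P.real (A j)| < t} with hG
  have hGm : MeasurableSet G := by
    rw [hG, Set.ofPred_forall]
    exact MeasurableSet.iInter fun j => measurableSet_lt
      ((measurable_empirical (hA j)).sub_const _).abs measurable_const
  have hGc : Gᶜ ⊆ ⋃ j, {D | t ≤ |empirical D (A j) - P.real (A j)|} := by
    intro D hD
    simpa [hG] using hD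
  have h1 : (Measure.pi fun _ : Fin n => P).real Gᶜ ≤ m * (2 * Real.exp (-2 * n * t ^ 2)) := by
    refine (measureReal_mono hGc).trans ((measureReal_iUnion_fintype_le _).trans ?_)
    refine (Finset.sum_le_sum fun j _ => measureReal_empirical_sub_ge_le P hn (hA j) ht).trans ?_
    simp
  have h2 := probReal_compl_eq_one_sub (μ := Measure.pi fun _ : Fin n => P) hGm
  change _ ≤ (Measure.pi fun _ : Fin n => P).real G
  linarith

/-- The rate condition makes the failure probability of the union bound arbitrarily small. -/
theorem eventually_union_bound_le {δ ε : ℕ → ℝ} {d c : ℝ} (hδpos : ∀ n, 0 < δ n)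
    (hεpos : ∀ n, 0 < ε n) (hδ : Tendsto δ atTop (𝓝 0)) (hd : 0 < d) (hc : 1 ≤ c)
    (hrate : Tendsto (fun n : ℕ =>
      Real.log (δ n)⁻¹ / ((n : ℝ) * (δ n) ^ (2 * d) * (ε n) ^ 2)) atTop (𝓝 0)) (ς : ℝ) :
    ∀ᶠ n : ℕ in atTop, c * δ n ^ (-d) *
      (2 * Real.exp (-2 * n * (ε n * (c⁻¹ * δ n ^ d)) ^ 2)) ≤ Real.exp (-ς) := by
  have hc0 : 0 < c := by linarith
  -- With this constant the exponential is at most `δ ^ (d + 1)`. It absorbs the number of cells, of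
  -- order `δ ^ (-d)`, and leaves `2 * c * δ`, which tends to `0`.
  have hκ : 0 < 2 / (c ^ 2 * (d + 1)) := by positivity
  have hsmall : ∀ᶠ n : ℕ in atTop, δ n < Real.exp (-ς) / (2 * c) :=
    hδ.eventually_lt_const (by positivity)
  filter_upwards [hrate.eventually_lt_const hκ, hsmall, eventually_gt_atTop 0] with n h1 h2 hn
  have hn' : (0 : ℝ) < n := by exact_mod_cast hn
  have hδn := hδpos n
  have hεn := hεpos n
  have hpow : δ n ^ (2 * d) = (δ n ^ d) ^ 2 := by
    rw [mul_comm, Real.rpow_mul hδn.le]; norm_num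
  rw [div_lt_iff₀ (by positivity), Real.log_inv, hpow] at h1
  have h3 : -2 * n * (ε n * (c⁻¹ * δ n ^ d)) ^ 2 ≤ (d + 1) * Real.log (δ n) := by
    have h4 : (d + 1) * (2 / (c ^ 2 * (d + 1)) * (n * (δ n ^ d) ^ 2 * ε n ^ 2)) =
        2 * n * (ε n * (c⁻¹ * δ n ^ d)) ^ 2 := by
      field_simp
    have h5 := mul_lt_mul_of_pos_left h1 (show 0 < d + 1 by linarith)
    rw [h4] at h5
    linarith
  have h6 : δ n ^ (-d) = Real.exp (-d * Real.log (δ n)) := by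
    rw [Real.rpow_def_of_pos hδn, mul_comm]
  calc _ ≤ c * Real.exp (-d * Real.log (δ n)) * (2 * Real.exp ((d + 1) * Real.log (δ n))) := by
        rw [h6]; gcongr
    _ = 2 * c * δ n := by
        have : Real.exp (-d * Real.log (δ n)) * Real.exp ((d + 1) * Real.log (δ n)) = δ n := by
          rw [← Real.exp_add, show -d * Real.log (δ n) + (d + 1) * Real.log (δ n) =
            Real.log (δ n) by ring, Real.exp_log hδn]
        linear_combination (2 * c) * this
    _ ≤ Real.exp (-ς) := by
        rw [lt_div_iff₀ (by positivity)] at h2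
        linarith

end Concentration

/-! ### Densities and histogram values -/

section Densities

variable {X : Type*} [MeasurableSpace X] {μ P : Measure X}

theorem IsDensity.ae_eq_rnDeriv [SigmaFinite μ] {h : X → ℝ} (hh : IsDensity μ P h) :
    ∀ᵐ x ∂μ, (P.rnDeriv μ x).toReal = h x := by
  have h1 : P.rnDeriv μ =ᵐ[μ] fun x => ENNReal.ofReal (h x) := by
    rw [hh.eq_withDensity]
    exact Measure.rnDeriv_withDensity μ hh.measurable.ennreal_ofReal
  filter_upwards [h1] with x hx
  rw [hx, ENNReal.toReal_ofReal (hh.nonneg x)]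

theorem histogram_eq {m n : ℕ} {A : Fin m → Set X} (hA : ∀ i j, i ≠ j → Disjoint (A i) (A j))
    (D : Fin n → X) {x : X} {j : Fin m} (hx : x ∈ A j) :
    histogram μ A D x = empirical D (A j) / μ.real (A j) := by
  rw [histogram, Finset.sum_eq_single j]
  · simp [hx]
  · intro i _ hij
    exact Set.indicator_of_notMem (Set.disjoint_right.1 (hA i j hij) hx) _
  · simp

end Densities

/-! ### Level sets and normality, almost everywhere -/

section LevelSetFacts

variable {X : Type*} [MetricSpace X] [MeasurableSpace X] {μ P : Measure X}

theorem isClosed_levelSet (μ P : Measure X) (ρ : ℝ) : IsClosed (levelSet μ P ρ) :=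
  Measure.isClosed_support

theorem levelSet_antitone (μ P : Measure X) : Antitone (levelSet μ P) := fun _ _ h =>
  Measure.support_mono (Measure.restrict_mono_set _ fun _ hx => h.trans hx)

/-- In a second countable space a measure is carried by its support. -/
theorem ae_mem_levelSet_of_le [SecondCountableTopology X] (μ P : Measure X) (ρ : ℝ) :
    ∀ᵐ x ∂μ, ρ ≤ (P.rnDeriv μ x).toReal → x ∈ levelSet μ P ρ := by
  have hm : MeasurableSet {x | ρ ≤ (P.rnDeriv μ x).toReal} :=
    measurableSet_le measurable_const (Measure.measurable_rnDeriv P μ).ennreal_toReal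
  exact (ae_restrict_iff' hm).1 Measure.support_mem_ae

theorem IsUpperNormalAt.ae_le [SigmaFinite μ] {ρ : ℝ} (h : IsUpperNormalAt μ P ρ) :
    ∀ᵐ x ∂μ, x ∈ levelSet μ P ρ → ρ ≤ (P.rnDeriv μ x).toReal := by
  obtain ⟨g, hg, h0⟩ := h
  filter_upwards [measure_eq_zero_iff_ae_notMem.1 h0, hg.ae_eq_rnDeriv] with x hx hx' hxM
  rw [hx']
  by_contra hlt
  exact hx ⟨hxM, hlt⟩

theorem IsLowerNormalAt.ae_mem_interior [SigmaFinite μ] {ρ : ℝ} (h : IsLowerNormalAt μ P ρ) :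
    ∀ᵐ x ∂μ, ρ < (P.rnDeriv μ x).toReal → x ∈ interior (levelSet μ P ρ) := by
  obtain ⟨g, hg, h0⟩ := h
  filter_upwards [measure_eq_zero_iff_ae_notMem.1 h0, hg.ae_eq_rnDeriv] with x hx hx' hxM
  by_contra hlt
  exact hx ⟨by rwa [hx'] at hxM, hlt⟩

end LevelSetFacts

/-! ### The histogram sandwich -/

section Histogram

variable {X : Type*} [MetricSpace X] [MeasurableSpace X] {μ P : Measure X}

/-- A support may exceed `{h ≥ ρ}` by a set of positive measure; upper normality excludes this, so
`h ≥ ρ` almost everywhere on `S`. -/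
theorem le_measureReal_of_subset_levelSet [IsFiniteMeasure μ] [IsFiniteMeasure P] (hPμ : P ≪ μ)
    {ρ : ℝ} (hn : IsUpperNormalAt μ P ρ) {S : Set X} (hS : MeasurableSet S)
    (hSM : S ⊆ levelSet μ P ρ) : ρ * μ.real S ≤ P.real S := by
  rw [← Measure.setIntegral_toReal_rnDeriv hPμ S]
  calc ρ * μ.real S = ∫ _ in S, ρ ∂μ := by simp [mul_comm]
    _ ≤ _ := by
      refine setIntegral_mono_on_ae integrableOn_const
        Measure.integrable_toReal_rnDeriv.integrableOn hS ?_
      filter_upwards [hn.ae_le] with x hx hxS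
      exact hx (hSM hxS)

theorem measureReal_le_of_disjoint_levelSet [SecondCountableTopology X] [IsFiniteMeasure μ]
    [IsFiniteMeasure P] (hPμ : P ≪ μ) {ρ : ℝ} {S : Set X} (hS : MeasurableSet S)
    (hSM : Disjoint S (levelSet μ P ρ)) : P.real S ≤ ρ * μ.real S := by
  rw [← Measure.setIntegral_toReal_rnDeriv hPμ S]
  calc ∫ x in S, (P.rnDeriv μ x).toReal ∂μ
    _ ≤ ∫ _ in S, ρ ∂μ := by
      refine setIntegral_mono_on_ae Measure.integrable_toReal_rnDeriv.integrableOn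
        integrableOn_const hS ?_
      filter_upwards [ae_mem_levelSet_of_le μ P ρ] with x hx hxS
      by_contra! hlt
      exact Set.disjoint_left.1 hSM hxS (hx hlt.le)
    _ = ρ * μ.real S := by simp [mul_comm]

/-- If the relative frequencies of the cells are close to their probabilities, then the level sets
of the histogram estimate the level sets of `P`. -/
theorem isEstimate_histogram [SecondCountableTopology X] [IsFiniteMeasure μ] [IsFiniteMeasure P]
    (hPμ : P ≪ μ) (hnormal : IsNormal μ P) {m n : ℕ} {A : Fin m → Set X} {δ ε s b ρss : ℝ}
    (hAm : ∀ j, MeasurableSet (A j)) (hAd : ∀ i j, i ≠ j → Disjoint (A i) (A j))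
    (hAc : ⋃ j, A j = Set.univ) (hAδ : ∀ j, ∀ x ∈ A j, ∀ y ∈ A j, dist x y ≤ δ) (hb : 0 < b)
    (hAb : ∀ j, b ≤ μ.real (A j)) (hε : 0 < ε) (hδ : 0 ≤ δ) (hs : δ < s)
    (hthick : ∀ r ∈ Set.Ioc 0 ρss, ∀ x ∈ levelSet μ P r,
      ∃ z ∈ tubeMinus δ (levelSet μ P r), dist x z < s)
    {D : Fin n → X} (hD : ∀ j, |empirical D (A j) - P.real (A j)| < ε * b) :
    IsEstimate (levelSet μ P) (fun ρ => {x | ρ ≤ histogram μ A D x}) ρss δ ε s where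
  pos := hε
  lt := hs
  nonneg := hδ
  anti _ _ h _ hx := h.trans hx
  thick := hthick
  inner ρ x hx := by
    obtain ⟨j, hj⟩ := Set.mem_iUnion.1 (hAc ▸ Set.mem_univ x)
    have hμ : 0 < μ.real (A j) := hb.trans_le (hAb j)
    have hsub : A j ⊆ levelSet μ P (ρ + ε) := by
      intro y hy
      by_contra hyM
      exact hx (Metric.mem_cthickening_of_dist_le x y δ _ hyM (hAδ j x hj y hy))
    have h1 := le_measureReal_of_subset_levelSet hPμ (hnormal _).1 (hAm j) hsub
    have h2 := (abs_lt.1 (hD j)).1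
    -- After division by the cell measure, the frequency error `ε * b` costs at most `ε` in height.
    have h3 : ε * b ≤ ε * μ.real (A j) := mul_le_mul_of_nonneg_left (hAb j) hε.le
    rw [Set.mem_ofPred_eq, histogram_eq hAd D hj, le_div_iff₀ hμ]
    linarith
  outer ρ x hx := by
    obtain ⟨j, hj⟩ := Set.mem_iUnion.1 (hAc ▸ Set.mem_univ x)
    have hμ : 0 < μ.real (A j) := hb.trans_le (hAb j)
    by_contra hxM
    have hdisj : Disjoint (A j) (levelSet μ P (ρ - ε)) := by
      rw [Set.disjoint_left]
      intro y hy hyM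
      exact hxM (Metric.mem_cthickening_of_dist_le x y δ _ hyM (hAδ j x hj y hy))
    have h1 := measureReal_le_of_disjoint_levelSet hPμ (hAm j) hdisj
    have h2 := (abs_lt.1 (hD j)).2
    have h3 : ε * b ≤ ε * μ.real (A j) := mul_le_mul_of_nonneg_left (hAb j) hε.le
    rw [Set.mem_ofPred_eq, histogram_eq hAd D hj, le_div_iff₀ hμ] at hx
    linarith

end Histogram

/-! ### Connected components of closed sets and cells over them -/

section ComponentFacts

variable {X : Type*} [TopologicalSpace X] {F : Set X} {a b x : X}

/-- The closure of the component is still preconnected and contained in `F`, so maximality applies.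
-/
theorem isClosed_connectedComponentIn (hF : IsClosed F) (a : X) :
    IsClosed (connectedComponentIn F a) := by
  by_cases ha : a ∈ F
  · refine isClosed_of_closure_subset
      (isPreconnected_connectedComponentIn.closure.subset_connectedComponentIn
        (subset_closure (mem_connectedComponentIn ha))
        (closure_minimal (connectedComponentIn_subset F a) hF))
  · rw [connectedComponentIn_eq_empty ha]
    exact isClosed_empty

theorem connectedComponentIn_disjoint_of_ne
    (h : connectedComponentIn F a ≠ connectedComponentIn F b) :
    Disjoint (connectedComponentIn F a) (connectedComponentIn F b) := by
  rw [Set.disjoint_left]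
  intro x hxa hxb
  exact h ((connectedComponentIn_eq hxa).trans (connectedComponentIn_eq hxb).symm)

theorem eq_connectedComponentIn_of_mem_components {B : Set X} (hB : B ∈ components F)
    (ha : a ∈ B) : B = connectedComponentIn F a := by
  obtain ⟨y, -, rfl⟩ := hB
  exact connectedComponentIn_eq ha

theorem connectedComponentIn_mem_components (ha : a ∈ F) :
    connectedComponentIn F a ∈ components F :=
  ⟨a, ha, rfl⟩

theorem cellOver_components {A' : Set X} (ha : a ∈ A') (hA' : A' ⊆ connectedComponentIn F a) :
    cellOver (components F) A' = connectedComponentIn F a := by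
  apply Set.Subset.antisymm
  · rintro x ⟨B, ⟨hB, hAB⟩, hx⟩
    rwa [← eq_connectedComponentIn_of_mem_components hB (hAB ha)]
  · intro x hx
    exact ⟨_, ⟨connectedComponentIn_mem_components
      (connectedComponentIn_subset _ _ (hA' ha)), hA'⟩, hx⟩

end ComponentFacts

/-! ### Separation of the branches and the returned sets -/

section Branches

variable {X : Type*} [MetricSpace X]

/-- A distance that the two branches keep from each other at a level above `ρs`. -/
theorem TwoBranches.exists_le_dist [CompactSpace X] {M : ℝ → Set X} {ρs ρss : ℝ} {a₁ a₂ : X}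
    (h : TwoBranches M ρs ρss a₁ a₂) {r : ℝ} (hr : r ∈ Set.Ioc ρs ρss) :
    ∃ Δ : ℝ, 0 < Δ ∧ ∀ a ∈ connectedComponentIn (M r) a₁, ∀ b ∈ connectedComponentIn (M r) a₂,
      Δ ≤ dist a b := by
  obtain ⟨Δ, hΔ, hd⟩ := Metric.exists_pos_forall_lt_edist
    (isClosed_connectedComponentIn (h.closed r) a₁).isCompact
    (isClosed_connectedComponentIn (h.closed r) a₂) (h.disjoint r hr)
  refine ⟨Δ, hΔ, fun a ha b hb => ?_⟩
  have := (hd a ha b hb).le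
  rw [edist_nndist] at this
  exact_mod_cast this

/-- The result of the algorithm for an estimate of two branches. -/
theorem IsEstimate.exists_returns {M L : ℝ → Set X} {ρs ρss δ ε s τ : ℝ} {a₁ a₂ : X}
    (hE : IsEstimate M L ρss δ ε s) (hM : TwoBranches M ρs ρss a₁ a₂) (hs : 3 * s ≤ τ) {r Δ : ℝ}
    (hr : ρs < r) (hr' : r + 8 * ε ≤ ρss)
    (hsep : ∀ a ∈ connectedComponentIn (M r) a₁, ∀ b ∈ connectedComponentIn (M r) a₂,
      Δ ≤ dist a b) (hΔ : τ + 2 * s ≤ Δ) :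
    ∃ (ρD : ℝ) (B₁ B₂ : Set X), B₁ ≠ B₂ ∧ Disjoint B₁ B₂ ∧ Returns τ ε L ρD {B₁, B₂} ∧
      ρs + 2 * ε ≤ ρD ∧ ρD ≤ r + 5 * ε ∧ B₁ ⊆ L ρD ∧ B₂ ⊆ L ρD ∧
      ∀ r' ≤ ρss, ρD + ε ≤ r' →
        connectedComponentIn (M r') a₁ ∩ tubeMinus δ (M r') ⊆ B₁ ∧
        connectedComponentIn (M r') a₂ ∩ tubeMinus δ (M r') ⊆ B₂ := by
  have hpos : 0 < ρss := hM.nonneg.trans_lt hM.lt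
  obtain ⟨z₁, hz₁, h₁⟩ := hE.thick ρss ⟨hpos, le_rfl⟩ a₁ hM.mem₁
  obtain ⟨z₂, hz₂, h₂⟩ := hE.thick ρss ⟨hpos, le_rfl⟩ a₂ hM.mem₂
  obtain ⟨ρD, hge, hle, hn, hret⟩ := hE.returns hM hs hz₁ hz₂ h₁ h₂ hr hr' hsep hΔ
  have hε := hE.pos
  have hρD : 0 ≤ ρD := by linarith [hM.nonneg]
  have hz₂L : z₂ ∈ L ρD := hE.subset_of_le hM.anti (by linarith) hz₂
  refine ⟨ρD, _, _, fun h => hn ((setOf_tauConnectedIn_eq_iff hz₂L).1 h), ?_, hret, hge, hle,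
    fun y hy => hy.2.1, fun y hy => hy.2.1, fun r' hr'ss hr' => ⟨?_, ?_⟩⟩
  · rw [Set.disjoint_left]
    exact fun y hy₁ hy₂ => hn (hy₁.trans hy₂.symm)
  · exact hE.inter_tubeMinus_subset hM.anti hs hz₁ hM.mem₁ h₁ hρD hr' hr'ss
  · exact hE.inter_tubeMinus_subset hM.anti hs hz₂ hM.mem₂ h₂ hρD hr' hr'ss

end Branches

/-! ### Branches of a clusterable distribution, measure of the clusters, the good event -/

section ClusteredFacts

variable {X : Type*} [MetricSpace X] [MeasurableSpace X] {μ P : Measure X} {ρs ρss : ℝ}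
  {A₁ A₂ : Set X} {a₁ a₂ : X}

/-- Fixed base points `a₁`, `a₂` replace the cell relating maps: the image of `Aᵢ` must be the
component of `aᵢ`. Injectivity of the map keeps the two apart when there are two components. -/
theorem CanBeClustered.components_eq (h : CanBeClustered μ P ρs ρss) (hA : A₁ ≠ A₂)
    (hcomp : components (levelSet μ P ρss) = {A₁, A₂}) (h₁ : a₁ ∈ A₁) (h₂ : a₂ ∈ A₂)
    (hm₁ : a₁ ∈ levelSet μ P ρss) (hm₂ : a₂ ∈ levelSet μ P ρss) {r : ℝ}
    (hr : r ∈ Set.Icc 0 ρss) :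
    components (levelSet μ P r) = {connectedComponentIn (levelSet μ P r) a₁,
      connectedComponentIn (levelSet μ P r) a₂} ∧
    (ρs < r → connectedComponentIn (levelSet μ P r) a₁ ≠
      connectedComponentIn (levelSet μ P r) a₂) := by
  have hM := levelSet_antitone μ P hr.2
  rcases h.one_or_two r hr with h1 | h2
  · refine ⟨?_, fun hlt => absurd (h.of_one r hr h1) hlt.not_ge⟩
    obtain ⟨B, hB⟩ := Set.encard_eq_one.1 h1
    have e₁ := connectedComponentIn_mem_components (hM hm₁)
    have e₂ := connectedComponentIn_mem_components (hM hm₂)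
    rw [hB, Set.mem_singleton_iff] at e₁ e₂
    rw [hB, e₁, e₂, Set.pair_eq_singleton]
  · obtain ⟨ζ, hζ, hsub⟩ := (h.of_two r hr h2).2
    rw [hcomp] at hζ hsub
    have m₁ : A₁ ∈ ({A₁, A₂} : Set (Set X)) := Or.inl rfl
    have m₂ : A₂ ∈ ({A₁, A₂} : Set (Set X)) := Or.inr rfl
    have e₁ := eq_connectedComponentIn_of_mem_components (hζ.mapsTo m₁) (hsub _ m₁ h₁)
    have e₂ := eq_connectedComponentIn_of_mem_components (hζ.mapsTo m₂) (hsub _ m₂ h₂)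
    rw [← e₁, ← e₂, ← hζ.image_eq, Set.image_pair]
    exact ⟨rfl, fun _ he => hA (hζ.injOn m₁ m₂ he)⟩

theorem CanBeClustered.twoBranches (h : CanBeClustered μ P ρs ρss) (hA : A₁ ≠ A₂)
    (hcomp : components (levelSet μ P ρss) = {A₁, A₂}) (h₁ : a₁ ∈ A₁) (h₂ : a₂ ∈ A₂)
    (hm₁ : a₁ ∈ levelSet μ P ρss) (hm₂ : a₂ ∈ levelSet μ P ρss) :
    TwoBranches (levelSet μ P) ρs ρss a₁ a₂ where
  nonneg := h.nonneg
  lt := h.lt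
  anti := levelSet_antitone μ P
  closed := isClosed_levelSet μ P
  mem₁ := hm₁
  mem₂ := hm₂
  eq_union r hr := by
    refine Set.Subset.antisymm (fun x hx => ?_)
      (Set.union_subset (connectedComponentIn_subset _ _) (connectedComponentIn_subset _ _))
    have hmem := connectedComponentIn_mem_components hx
    rw [(h.components_eq hA hcomp h₁ h₂ hm₁ hm₂ hr).1] at hmem
    rcases hmem with he | he
    · exact Or.inl (he ▸ mem_connectedComponentIn hx)
    · exact Or.inr (he ▸ mem_connectedComponentIn hx)
  disjoint r hr := connectedComponentIn_disjoint_of_ne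
    ((h.components_eq hA hcomp h₁ h₂ hm₁ hm₂ ⟨h.nonneg.trans hr.1.le, hr.2⟩).2 hr.1)
  le_of_ne r hr hne := by
    refine (h.of_two r hr ?_).1
    rw [(h.components_eq hA hcomp h₁ h₂ hm₁ hm₂ hr).1, Set.encard_pair hne]

theorem cluster_eq {C : Set X} {a : X} (hC : C ∈ components (levelSet μ P ρss)) (ha : a ∈ C) :
    cluster μ P ρs ρss C =
      ⋃ r ∈ Set.Ioc ρs ρss, connectedComponentIn (levelSet μ P r) a := by
  refine Set.iUnion₂_congr fun r hr => cellOver_components ha ?_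
  rw [eq_connectedComponentIn_of_mem_components hC ha]
  exact connectedComponentIn_mono _ (levelSet_antitone μ P hr.2)

/-- The interior parts of a cluster at a single level exhaust its measure. -/
theorem exists_measure_cluster_diff_le [BorelSpace X] [IsFiniteMeasure μ]
    (hnormal : IsNormal μ P) (hlt : ρs < ρss) (a : X) {η : ℝ≥0∞} (hη : 0 < η) :
    ∃ r ∈ Set.Ioc ρs ρss, ∃ κ > 0,
      μ ((⋃ r ∈ Set.Ioc ρs ρss, connectedComponentIn (levelSet μ P r) a) \
        (connectedComponentIn (levelSet μ P r) a ∩ tubeMinus κ (levelSet μ P r))) ≤ η := by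
  set M := levelSet μ P with hM
  have hanti : Antitone M := levelSet_antitone μ P
  set U := ⋃ r ∈ Set.Ioc ρs ρss, connectedComponentIn (M r) a with hU
  -- Countably many levels decreasing to `ρs`, so that the null sets from normality can be united.
  set ℓ : ℕ → ℝ := fun k => ρs + (ρss - ρs) * (1 / ((k : ℝ) + 1)) with hℓ
  have hd : 0 < ρss - ρs := by linarith
  have hℓmem : ∀ k, ℓ k ∈ Set.Ioc ρs ρss := by
    intro k
    have h1 : 0 < 1 / ((k : ℝ) + 1) := by positivity
    have h2 : 1 / ((k : ℝ) + 1) ≤ 1 := by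
      rw [div_le_one (by positivity)]; linarith [k.cast_nonneg (α := ℝ)]
    constructor
    · simp only [hℓ]; nlinarith
    · simp only [hℓ]; nlinarith
  have hℓanti : StrictAnti ℓ := by
    intro i j hij
    have : 1 / ((j : ℝ) + 1) < 1 / ((i : ℝ) + 1) := by gcongr
    simp only [hℓ]
    nlinarith
  have hℓlim : Tendsto ℓ atTop (𝓝 ρs) := by
    simpa [hℓ] using (tendsto_one_div_add_atTop_nhds_zero_nat (𝕜 := ℝ)).const_mul (ρss - ρs)
      |>.const_add ρs
  set G : ℕ → Set X := fun k =>
    connectedComponentIn (M (ℓ k)) a ∩ tubeMinus (1 / ((k : ℝ) + 1)) (M (ℓ k)) with hG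
  have hGmono : Monotone G := by
    intro i j hij
    have h1 : 1 / ((j : ℝ) + 1) ≤ 1 / ((i : ℝ) + 1) := by gcongr
    have h2 : M (ℓ i) ⊆ M (ℓ j) := hanti (hℓanti.antitone hij)
    exact Set.inter_subset_inter (connectedComponentIn_mono _ h2)
      ((tubeMinus_mono h2).trans (tubeMinus_anti h1 _))
  have hGm : ∀ k, MeasurableSet (G k) := fun k =>
    (isClosed_connectedComponentIn (isClosed_levelSet μ P _) a).measurableSet.inter
      (isOpen_tubeMinus _ _).measurableSet
  have hUG : μ (U \ ⋃ k, G k) = 0 := by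
    rw [measure_eq_zero_iff_ae_notMem]
    have hup : ∀ᵐ x ∂μ, ∀ k, x ∈ M (ℓ k) → ℓ k ≤ (P.rnDeriv μ x).toReal :=
      ae_all_iff.2 fun k => (hnormal (ℓ k)).1.ae_le
    have hlo : ∀ᵐ x ∂μ, ∀ k, ℓ k < (P.rnDeriv μ x).toReal → x ∈ interior (M (ℓ k)) :=
      ae_all_iff.2 fun k => (hnormal (ℓ k)).2.ae_mem_interior
    filter_upwards [hup, hlo] with x h1 h2 hx
    refine hx.2 ?_
    obtain ⟨r, hr, hxr⟩ := Set.mem_iUnion₂.1 hx.1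
    obtain ⟨k, hk⟩ := (hℓlim.eventually_lt_const hr.1).exists
    have hxk : ∀ j ≥ k, x ∈ connectedComponentIn (M (ℓ j)) a := fun j hj =>
      connectedComponentIn_mono _ (hanti ((hℓanti.antitone hj).trans hk.le)) hxr
    -- Lower normality needs a strict inequality: upper normality gives `h x ≥ ℓ k`, and `ℓ k > ℓ (k
    -- + 1)`.
    have hint : x ∈ interior (M (ℓ (k + 1))) := h2 _ ((hℓanti k.lt_succ_self).trans_le
      (h1 k (connectedComponentIn_subset _ _ (hxk k le_rfl))))
    have hev : ∀ᶠ j : ℕ in atTop, x ∈ tubeMinus (1 / ((j : ℝ) + 1)) (M (ℓ (k + 1))) := by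
      have hcl : x ∉ closure (M (ℓ (k + 1)))ᶜ := by
        rwa [closure_compl, Set.mem_compl_iff, not_not]
      exact (tendsto_one_div_add_atTop_nhds_zero_nat (𝕜 := ℝ)).eventually
        (Metric.eventually_notMem_cthickening_of_infEDist_pos hcl)
    obtain ⟨j, hj, hjk⟩ := (hev.and (eventually_ge_atTop (k + 1))).exists
    exact Set.mem_iUnion.2 ⟨j, hxk j (by omega),
      tubeMinus_mono (hanti (hℓanti.antitone hjk)) hj⟩
  have hlim : Tendsto (fun k => μ ((⋃ i, G i) \ G k)) atTop (𝓝 0) := by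
    have h := tendsto_measure_iInter_atTop (μ := μ) (s := fun k => (⋃ i, G i) \ G k)
      (fun k => ((MeasurableSet.iUnion hGm).diff (hGm k)).nullMeasurableSet)
      (fun i j hij => Set.sdiff_subset_sdiff_right (hGmono hij)) ⟨0, measure_ne_top _ _⟩
    have he : (⋂ k, (⋃ i, G i) \ G k) = ∅ := by
      rw [Set.eq_empty_iff_forall_notMem]
      intro x hx
      rw [Set.mem_iInter] at hx
      obtain ⟨i, hi⟩ := Set.mem_iUnion.1 (hx 0).1
      exact (hx i).2 hi
    rwa [he, measure_empty] at h
  obtain ⟨k, hk⟩ := (hlim.eventually_le_const hη).exists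
  refine ⟨ℓ k, hℓmem k, 1 / ((k : ℝ) + 1), by positivity, ?_⟩
  calc μ (U \ G k) ≤ μ ((U \ ⋃ i, G i) ∪ ((⋃ i, G i) \ G k)) := by
        refine measure_mono fun x hx => ?_
        by_cases h : x ∈ ⋃ i, G i
        · exact Or.inr ⟨h, hx.2⟩
        · exact Or.inl ⟨hx.1, h⟩
    _ ≤ μ (U \ ⋃ i, G i) + μ ((⋃ i, G i) \ G k) := measure_union_le _ _
    _ ≤ η := by rw [hUG, zero_add]; exact hk

/-- Closed tubes shrink to the closure, which exceeds `U` by a null set only. -/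
theorem tendsto_measure_cthickening_diff [OpensMeasurableSpace X] [IsFiniteMeasure μ] {U : Set X}
    (hU : μ (closure U \ U) = 0) {δ : ℕ → ℝ} (hδ : Tendsto δ atTop (𝓝 0)) :
    Tendsto (fun n => μ (Metric.cthickening (δ n) U \ U)) atTop (𝓝 0) := by
  have h1 : Tendsto (fun n => μ (Metric.cthickening (δ n) U) - μ (closure U)) atTop (𝓝 0) := by
    have h := (tendsto_measure_cthickening (μ := μ) (s := U)
      ⟨1, one_pos, measure_ne_top _ _⟩).comp hδ
    have h' := ENNReal.Tendsto.sub h (tendsto_const_nhds (x := μ (closure U)))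
      (Or.inl (measure_ne_top _ _))
    rwa [tsub_self] at h'
  refine tendsto_of_tendsto_of_tendsto_of_le_of_le tendsto_const_nhds h1 (fun _ => zero_le) ?_
  intro n
  have hcl : closure U ⊆ Metric.cthickening (δ n) U := Metric.closure_subset_cthickening _ _
  calc μ (Metric.cthickening (δ n) U \ U)
      ≤ μ ((Metric.cthickening (δ n) U \ closure U) ∪ (closure U \ U)) := by
        refine measure_mono fun x hx => ?_
        by_cases h : x ∈ closure U
        · exact Or.inr ⟨h, hx.2⟩
        · exact Or.inl ⟨hx.1, h⟩
    _ ≤ _ := measure_union_le _ _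
    _ = μ (Metric.cthickening (δ n) U) - μ (closure U) := by
        rw [hU, add_zero, measure_sdiff hcl isClosed_closure.nullMeasurableSet (measure_ne_top _ _)]

/-- The good event on which the histogram estimates the level sets has a large probability. -/
theorem eventually_le_measure_isEstimate [CompactSpace X] [BorelSpace X] [IsFiniteMeasure μ]
    [IsProbabilityMeasure P] (hPμ : P ≪ μ) (hnormal : IsNormal μ P) {γ cThick δThick : ℝ}
    (hthick : HasThickLevels μ P ρss γ cThick δThick) {m : ℝ → ℕ}
    {A : (δ : ℝ) → Fin (m δ) → Set X} {dPart cPart : ℝ}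
    (hpart : IsPartitionFamily μ m A dPart cPart) {δ ε τ : ℕ → ℝ} (hδpos : ∀ n, 0 < δ n)
    (hεpos : ∀ n, 0 < ε n) (hδ : Tendsto δ atTop (𝓝 0))
    (hψτ : ∀ᶠ n in atTop, thicknessFun γ cThick (δ n) < τ n)
    (hrate : Tendsto (fun n : ℕ =>
      Real.log (δ n)⁻¹ / ((n : ℝ) * (δ n) ^ (2 * dPart) * (ε n) ^ 2)) atTop (𝓝 0)) (ς : ℝ) :
    ∀ᶠ n : ℕ in atTop, ENNReal.ofReal (1 - Real.exp (-ς)) ≤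
      (Measure.pi fun _ : Fin n => P) {D | IsEstimate (levelSet μ P)
        (fun ρ => {x | ρ ≤ histogram μ (A (δ n)) D x}) ρss (δ n) (ε n) (τ n / 3)} := by
  have hδT : ∀ᶠ n in atTop, δ n < δThick := hδ.eventually_lt_const hthick.width_mem.1
  have hc0 : 0 < cPart := by linarith [hpart.one_le]
  filter_upwards [hψτ, hδT, eventually_gt_atTop 0, eventually_union_bound_le hδpos hεpos hδ
    hpart.dim_pos hpart.one_le hrate ς] with n h1 h2 hn h3
  have hδn := hδpos n
  have hδ1 : δ n ∈ Set.Ioc (0 : ℝ) 1 := ⟨hδn, h2.le.trans hthick.width_mem.2⟩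
  have hpow : δ n ≤ cThick * δ n ^ γ := by
    have h4 : δ n ≤ δ n ^ γ := by
      conv_lhs => rw [← Real.rpow_one (δ n)]
      exact Real.rpow_le_rpow_of_exponent_ge hδn hδ1.2 hthick.order_mem.2
    exact h4.trans (le_mul_of_one_le_left (Real.rpow_nonneg hδn.le _) hthick.one_le)
  -- The factor `3` in `ψ` matches the three legs of a shadowed step, with `s = τ n / 3`.
  have hlt : cThick * δ n ^ γ < τ n / 3 := by
    rw [thicknessFun] at h1
    linarith
  have hτ0 : 0 < τ n / 3 := (hδn.trans_le hpow).trans hlt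
  set b := cPart⁻¹ * δ n ^ dPart with hb
  have hb0 : 0 < b := by positivity
  have hεb : 0 ≤ ε n * b := mul_nonneg (hεpos n).le hb0.le
  -- The target event need not be measurable; it suffices that it contains the measurable
  -- concentration event.
  refine le_trans (ENNReal.ofReal_le_ofReal ?_)
    ((ofReal_le_measure_forall_empirical_sub_lt P hn (hpart.measurableSet (δ n) hδ1) hεb).trans
      (measure_mono fun D hD => ?_))
  · have h5 := mul_le_mul_of_nonneg_right (hpart.card_le (δ n) hδ1)
      (show 0 ≤ 2 * Real.exp (-2 * n * (ε n * b) ^ 2) by positivity)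
    linarith
  · refine isEstimate_histogram hPμ hnormal (hpart.measurableSet _ hδ1) (hpart.disjoint _ hδ1)
      (hpart.cover _ hδ1) (hpart.diam_le _ hδ1) hb0 (hpart.le_measure _ hδ1) (hεpos n) hδn.le
      (hpow.trans_lt hlt) (fun r hr x hx => ?_) hD
    have h6 := (hthick.thick (δ n) ⟨hδn, h2.le⟩ r hr x hx).trans_lt
      ((ENNReal.ofReal_lt_ofReal_iff hτ0).2 hlt)
    obtain ⟨z, hz, hxz⟩ := Metric.infEDist_lt_iff.1 h6
    exact ⟨z, hz, by rwa [edist_dist, ENNReal.ofReal_lt_ofReal_iff hτ0] at hxz⟩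

end ClusteredFacts

/-- A surplus point of `B` lies either outside both clusters or in the other cluster `U'`; in the
latter case disjointness makes it a point that `B'` misses. -/
theorem measure_symmDiff_le {X : Type*} [MeasurableSpace X] (μ : Measure X) {B B' U U' V : Set X}
    (hB : B ⊆ V) (hd : Disjoint B B') :
    μ (B ∆ U) ≤ μ (U \ B) + (μ (V \ (U ∪ U')) + μ (U' \ B')) := by
  calc μ (B ∆ U) ≤ μ ((U \ B) ∪ ((V \ (U ∪ U')) ∪ (U' \ B'))) := by
        refine measure_mono fun x hx => ?_
        rcases hx with ⟨hxB, hxU⟩ | hx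
        · by_cases hxU' : x ∈ U'
          · exact Or.inr (Or.inr ⟨hxU', Set.disjoint_left.1 hd hxB⟩)
          · exact Or.inr (Or.inl ⟨hB hxB, fun h => h.elim hxU hxU'⟩)
        · exact Or.inl hx
    _ ≤ μ (U \ B) + μ ((V \ (U ∪ U')) ∪ (U' \ B')) := measure_union_le _ _
    _ ≤ _ := by gcongr; exact measure_union_le _ _

end DensityClustering

/-! ### The main theorem -/

open DensityClustering in
theorem theorem4p1 {X : Type*} [MetricSpace X] [CompactSpace X] [MeasurableSpace X] [BorelSpace X]
    (μ : Measure X) [IsFiniteMeasure μ] (P : Measure X) [IsProbabilityMeasure P]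
    (hPμ : P ≪ μ) (hnormal : IsNormal μ P)
    (ρs ρss : ℝ) (hclust : CanBeClustered μ P ρs ρss)
    (A₁ A₂ : Set X) (hA : A₁ ≠ A₂) (hcomp : components (levelSet μ P ρss) = {A₁, A₂})
    (γ cThick δThick : ℝ) (hthick : HasThickLevels μ P ρss γ cThick δThick)
    (m : ℝ → ℕ) (A : (δ : ℝ) → Fin (m δ) → Set X) (dPart cPart : ℝ)
    (hpart : IsPartitionFamily μ m A dPart cPart)
    (δ ε τ : ℕ → ℝ) (hδpos : ∀ n, 0 < δ n) (hεpos : ∀ n, 0 < ε n) (hτpos : ∀ n, 0 < τ n)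
    (hδ : Tendsto δ atTop (𝓝 0)) (hε : Tendsto ε atTop (𝓝 0)) (hτ : Tendsto τ atTop (𝓝 0))
    (hψτ : ∀ᶠ n in atTop, thicknessFun γ cThick (δ n) < τ n)
    (hrate : Tendsto (fun n : ℕ =>
      Real.log (δ n)⁻¹ / ((n : ℝ) * (δ n) ^ (2 * dPart) * (ε n) ^ 2)) atTop (𝓝 0)) :
    (∀ ϵ : ℝ, 0 < ϵ → ∀ ς : ℝ, 1 ≤ ς → ∃ n₀ : ℕ, ∀ n ≥ n₀,
      ENNReal.ofReal (1 - Real.exp (-ς)) ≤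
        (Measure.pi fun _ : Fin n => P) {D : Fin n → X |
          ∃ (ρD : ℝ) (ℬ : Set (Set X)),
            HistogramReturns μ (A (δ n)) (τ n) (ε n) D ρD ℬ ∧
            0 < ρD - ρs ∧ ρD - ρs ≤ ϵ}) ∧
    (μ (closure (cluster μ P ρs ρss A₁ ∪ cluster μ P ρs ρss A₂) \
        (cluster μ P ρs ρss A₁ ∪ cluster μ P ρs ρss A₂)) = 0 →
      ∀ ϵ : ℝ, 0 < ϵ → ∀ ς : ℝ, 1 ≤ ς → ∃ n₀ : ℕ, ∀ n ≥ n₀,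
        ENNReal.ofReal (1 - Real.exp (-ς)) ≤
          (Measure.pi fun _ : Fin n => P) {D : Fin n → X |
            ∃ (ρD : ℝ) (B₁ B₂ : Set X), B₁ ≠ B₂ ∧
              HistogramReturns μ (A (δ n)) (τ n) (ε n) D ρD {B₁, B₂} ∧
              0 < ρD - ρs ∧ ρD - ρs ≤ ϵ ∧
              μ (B₁ ∆ cluster μ P ρs ρss A₁) + μ (B₂ ∆ cluster μ P ρs ρss A₂) ≤
                ENNReal.ofReal ϵ}) := by
  have hmem : ∀ C ∈ components (levelSet μ P ρss), ∃ a ∈ C, a ∈ levelSet μ P ρss := by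
    rintro C ⟨a, ha, rfl⟩
    exact ⟨a, mem_connectedComponentIn ha, ha⟩
  have hc₁ : A₁ ∈ components (levelSet μ P ρss) := by rw [hcomp]; exact Or.inl rfl
  have hc₂ : A₂ ∈ components (levelSet μ P ρss) := by rw [hcomp]; exact Or.inr rfl
  obtain ⟨a₁, h₁, hm₁⟩ := hmem A₁ hc₁
  obtain ⟨a₂, h₂, hm₂⟩ := hmem A₂ hc₂
  have hM := hclust.twoBranches hA hcomp h₁ h₂ hm₁ hm₂
  have hlt := hclust.lt
  have hgood := eventually_le_measure_isEstimate (ρss := ρss) hPμ hnormal hthick hpart hδpos hεpos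
    hδ hψτ hrate
  rw [cluster_eq hc₁ h₁, cluster_eq hc₂ h₂]
  constructor
  · intro ϵ hϵ ς _
    -- With `r = ρs + q` and `ε n < q / 8`, both `r + 8 * ε n` and the returned level stay below `ρs
    -- + 2 * q`. From `τ n < Δ / 2` it follows that `τ n + 2 * (τ n / 3) ≤ Δ`.
    set q := min ϵ (ρss - ρs) / 2 with hq
    have hq0 : 0 < q := half_pos (lt_min hϵ (by linarith))
    have hqϵ : 2 * q ≤ ϵ := by linarith [min_le_left ϵ (ρss - ρs)]
    have hqρ : 2 * q ≤ ρss - ρs := by linarith [min_le_right ϵ (ρss - ρs)]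
    obtain ⟨Δ, hΔ, hsep⟩ := hM.exists_le_dist (r := ρs + q) ⟨by linarith, by linarith⟩
    obtain ⟨n₀, hn₀⟩ := eventually_atTop.1 ((hgood ς).and
      ((hε.eventually_lt_const (show 0 < q / 8 by linarith)).and
        (hτ.eventually_lt_const (show 0 < Δ / 2 by linarith))))
    refine ⟨n₀, fun n hn => ?_⟩
    obtain ⟨hprob, hεn, hτn⟩ := hn₀ n hn
    have hε0 := hεpos n
    refine hprob.trans (measure_mono fun D hE => ?_)
    obtain ⟨ρD, B₁, B₂, -, -, hret, hge, hle, -⟩ := IsEstimate.exists_returns hE hM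
      (τ := τ n) (by linarith) (r := ρs + q) (by linarith) (by linarith) hsep (by linarith)
    exact ⟨ρD, _, hret, by linarith, by linarith⟩
  · intro hU ϵ hϵ ς _
    set U₁ := ⋃ r ∈ Set.Ioc ρs ρss, connectedComponentIn (levelSet μ P r) a₁ with hU₁
    set U₂ := ⋃ r ∈ Set.Ioc ρs ρss, connectedComponentIn (levelSet μ P r) a₂ with hU₂
    have hη : 0 < ENNReal.ofReal (ϵ / 6) := ENNReal.ofReal_pos.2 (by linarith)
    obtain ⟨r₁, hr₁, κ₁, hκ₁, hμ₁⟩ := exists_measure_cluster_diff_le hnormal hlt a₁ hη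
    obtain ⟨r₂, hr₂, κ₂, hκ₂, hμ₂⟩ := exists_measure_cluster_diff_le hnormal hlt a₂ hη
    -- This `q` also forces `ρD + ε n ≤ r₁, r₂`, so the interiors at these two fixed levels are
    -- captured.
    set q := min ϵ (min r₁ r₂ - ρs) / 2 with hq
    have hq0 : 0 < q := half_pos (lt_min hϵ (by linarith [lt_min hr₁.1 hr₂.1]))
    have hqϵ : 2 * q ≤ ϵ := by linarith [min_le_left ϵ (min r₁ r₂ - ρs)]
    have hqr : 2 * q ≤ min r₁ r₂ - ρs := by linarith [min_le_right ϵ (min r₁ r₂ - ρs)]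
    have hqr₁ : 2 * q ≤ r₁ - ρs := by linarith [min_le_left r₁ r₂]
    have hqr₂ : 2 * q ≤ r₂ - ρs := by linarith [min_le_right r₁ r₂]
    have hrss := hr₁.2
    obtain ⟨Δ, hΔ, hsep⟩ := hM.exists_le_dist (r := ρs + q) ⟨by linarith, by linarith⟩
    obtain ⟨n₀, hn₀⟩ := eventually_atTop.1 ((hgood ς).and
      ((hε.eventually_lt_const (show 0 < q / 8 by linarith)).and
        ((hτ.eventually_lt_const (show 0 < Δ / 2 by linarith)).and
          ((hδ.eventually_lt_const hκ₁).and ((hδ.eventually_lt_const hκ₂).and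
            ((tendsto_measure_cthickening_diff hU hδ).eventually_le_const hη))))))
    refine ⟨n₀, fun n hn => ?_⟩
    obtain ⟨hprob, hεn, hτn, hδ₁, hδ₂, hμ₃⟩ := hn₀ n hn
    have hε0 := hεpos n
    refine hprob.trans (measure_mono fun D hE => ?_)
    obtain ⟨ρD, B₁, B₂, hne, hdisj, hret, hge, hle, hL₁, hL₂, hin⟩ :=
      IsEstimate.exists_returns hE hM (τ := τ n) (by linarith) (r := ρs + q) (by linarith)
        (by linarith) hsep (by linarith)
    refine ⟨ρD, B₁, B₂, hne, hret, by linarith, by linarith, ?_⟩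
    have hLU : ({x | ρD ≤ histogram μ (A (δ n)) D x} : Set X) ⊆
        Metric.cthickening (δ n) (U₁ ∪ U₂) := by
      refine (hE.outer ρD).trans (Metric.cthickening_subset_of_subset _ ?_)
      -- The final upward shift of the algorithm gives `ρD ≥ ρs + 2 * ε n`; so even `ρD - ε n` lies
      -- above `ρs`, where the level set is part of the clusters.
      have hmem : ρD - ε n ∈ Set.Ioc ρs ρss := ⟨by linarith, by linarith⟩
      rw [hM.eq_union _ ⟨hM.nonneg.trans hmem.1.le, hmem.2⟩]
      exact Set.union_subset_union (Set.subset_biUnion_of_mem (u := fun r =>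
        connectedComponentIn (levelSet μ P r) a₁) hmem) (Set.subset_biUnion_of_mem (u := fun r =>
        connectedComponentIn (levelSet μ P r) a₂) hmem)
    have hd₁ : μ (U₁ \ B₁) ≤ ENNReal.ofReal (ϵ / 6) :=
      (measure_mono (Set.sdiff_subset_sdiff_right ((Set.inter_subset_inter_right _
        (tubeMinus_anti hδ₁.le _)).trans (hin r₁ hr₁.2 (by linarith)).1))).trans hμ₁
    have hd₂ : μ (U₂ \ B₂) ≤ ENNReal.ofReal (ϵ / 6) :=
      (measure_mono (Set.sdiff_subset_sdiff_right ((Set.inter_subset_inter_right _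
        (tubeMinus_anti hδ₂.le _)).trans (hin r₂ hr₂.2 (by linarith)).2))).trans hμ₂
    have e₁ := measure_symmDiff_le μ (U := U₁) (U' := U₂) (hL₁.trans hLU) hdisj
    have e₂ := measure_symmDiff_le μ (U := U₂) (U' := U₁) (hL₂.trans hLU) hdisj.symm
    rw [Set.union_comm U₂ U₁] at e₂
    calc μ (B₁ ∆ U₁) + μ (B₂ ∆ U₂)
        ≤ (ENNReal.ofReal (ϵ / 6) + (ENNReal.ofReal (ϵ / 6) + ENNReal.ofReal (ϵ / 6))) +
          (ENNReal.ofReal (ϵ / 6) + (ENNReal.ofReal (ϵ / 6) + ENNReal.ofReal (ϵ / 6))) := by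
          refine (add_le_add e₁ e₂).trans ?_
          gcongr
      _ = ENNReal.ofReal ϵ := by
          rw [show ϵ = 6 * (ϵ / 6) by ring, ENNReal.ofReal_mul (by norm_num),
            show 6 * (ϵ / 6) / 6 = ϵ / 6 by ring, ENNReal.ofReal_ofNat]
          ring
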